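/- Let $\mathcal X,\mathcal Y$ be finite nonempty alphabets and let $\mathcal W$ be a discrete memoryless channel (DMC) with channel matrix $W(y|x)$, that is, $W(y|x)\ge 0$, $\sum_{y\in\mathcal Y}W(y|x)=1$ for every $x\in\mathcal X$, and $$W^n(y^n|x^n)=\prod_{t=1}^n W(y_t|x_t),\qquad W^n(D|x^n)=\sum_{y^n\in D}W^n(y^n|x^n)\quad(D\subseteq\mathcal Y^n).$$ Let $\phi:\mathcal X\to[0,\infty)$ be a cost function and $\phi_{\max}=\max_{x\in\mathcal X}\phi(x)$. For $A\ge 0$, a deterministic identification (DI) code with $M$ messages and block length $n$ under the input constraint $A$ consists of codewords $u_1,\dots,u_M\in\mathcal X^n$ with $\frac1n\sum_{t=1}^n\phi(u_{i,t})\le A$ for all $i$, and of decoding regions $\mathcal D_1,\dots,\mathcal D_M\subseteq\mathcal Y^n$, which may overlap. A rate $R>0$ is achievable if for all $\lambda_1,\lambda_2>0$ and all sufficiently large $n$ there is such a code with $M=\lceil 2^{nR}\rceil$ messages and $$W^n(\mathcal D_i^c|u_i)\le\lambda_1\ \text{ for all } i,\qquad W^n(\mathcal D_j|u_i)\le\lambda_2\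 \text{ for all } i\ne j .$$ The DI capacity $\mathbb C_{DI}(\mathcal W)$ under the input constraint $A$ is the supremum in $[0,\infty]$ of the achievable rates (equal to $0$ if no rate $R>0$ is achievable). Then, without an effective input constraint, i.e. for $A=\phi_{\max}$, $$\mathbb C_{DI}(\mathcal W)=\log_2 n_{row}(W),$$ where $n_{row}(W)$ is the number of distinct rows $W(\cdot|x)$, $x\in\mathcal X$, of the channel matrix $W$. -/

import Mathlib

open scoped NNReal ENNReal

namespace DetId

/-- A discrete memoryless channel with input alphabet `X` and output alphabet `Y`:
a channel matrix whose row `x` is the conditional pmf `W(· | x)` on `Y`. -/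
structure DMC (X Y : Type*) [Fintype Y] where
  W : Matrix X Y ℝ
  nonneg : ∀ x y, 0 ≤ W x y
  row_sum : ∀ x, ∑ y, W x y = 1

/-- `W^n(D | x^n) = ∑_{y^n ∈ D} ∏_t W(y_t | x_t)`. -/
noncomputable def DMC.blockProb {X Y : Type*} [Fintype Y] (Ch : DMC X Y) {n : ℕ}
    (x : Fin n → X) (D : Set (Fin n → Y)) : ℝ :=
  ∑ y : Fin n → Y, D.indicator (fun y => ∏ t, Ch.W (x t) (y t)) y

/-- `n_row(W)`, the number of distinct rows of the channel matrix. -/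
noncomputable def DMC.numRows {X Y : Type*} [Fintype Y] (Ch : DMC X Y) : ℕ :=
  (Set.range (fun x : X => Ch.W x)).ncard

/-- `φ^n(x^n) = (1/n) ∑_t φ(x_t)`. -/
noncomputable def blockCost {X : Type*} (φ : X → ℝ≥0) {n : ℕ} (x : Fin n → X) : ℝ≥0 :=
  (1 / (n : ℝ≥0)) * ∑ t, φ (x t)

/-- `φ_max = max_x φ(x)` (for a finite nonempty alphabet). -/
noncomputable def maxCost {X : Type*} [Fintype X] (φ : X → ℝ≥0) : ℝ≥0 :=
  Finset.univ.sup φ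

/-- A deterministic identification code with `M` messages and block length `n` under the input
constraint `A`. The codewords are not required to be distinct, and the decoding regions may
overlap. -/
structure DICode (X Y : Type*) (φ : X → ℝ≥0) (A : ℝ≥0) (M n : ℕ) where
  codeword : Fin M → Fin n → X
  region : Fin M → Set (Fin n → Y)
  cost_le : ∀ i, blockCost φ (codeword i) ≤ A

/-- Type I error probability `W^n(D_i^c | u_i)` (missed identification). -/
noncomputable def DICode.errI {X Y : Type*} [Fintype Y] {φ : X → ℝ≥0} {A : ℝ≥0} {M n : ℕ}
    (C : DICode X Y φ A M n) (Ch : DMC X Y) (i : Fin M) : ℝ :=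
  Ch.blockProb (C.codeword i) (C.region i)ᶜ

/-- Type II error probability `W^n(D_j | u_i)` (false identification). -/
noncomputable def DICode.errII {X Y : Type*} [Fintype Y] {φ : X → ℝ≥0} {A : ℝ≥0} {M n : ℕ}
    (C : DICode X Y φ A M n) (Ch : DMC X Y) (i j : Fin M) : ℝ :=
  Ch.blockProb (C.codeword i) (C.region j)

/-- The rate `R > 0` is achievable: for all `λ₁, λ₂ > 0` and all sufficiently large `n` there is a
DI code with `2^{nR}` messages (rounded up when this is not an integer), block length `n` and error
probabilities at most `λ₁` and `λ₂`. -/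
def Achievable {X Y : Type*} [Fintype Y] (Ch : DMC X Y) (φ : X → ℝ≥0) (A : ℝ≥0) (R : ℝ) : Prop :=
  0 < R ∧ ∀ lam₁ lam₂ : ℝ, 0 < lam₁ → 0 < lam₂ → ∃ n₀ : ℕ, ∀ n : ℕ, n₀ ≤ n →
    ∃ C : DICode X Y φ A ⌈(2 : ℝ) ^ ((n : ℝ) * R)⌉₊ n,
      (∀ i, C.errI Ch i ≤ lam₁) ∧ ∀ i j, i ≠ j → C.errII Ch i j ≤ lam₂

/-- The DI capacity: the supremum in `[0, ∞]` of the achievable rates (it is `0` if no positive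
rate is achievable). -/
noncomputable def diCapacity {X Y : Type*} [Fintype Y] (Ch : DMC X Y) (φ : X → ℝ≥0) (A : ℝ≥0) :
    ℝ≥0∞ :=
  ⨆ (R : ℝ) (_ : Achievable Ch φ A R), ENNReal.ofReal R

end DetId

namespace DetId

open Filter Topology

/-! ### Tail bounds for scores of the channel output. -/

section Concentration

variable {X Y : Type*} [Fintype Y]

/-! Converse (`DICode.card_le`): codewords with the same sequence of rows induce the same output
law, so if the errors sum to less than `1` the row sequences are distinct. Achievability: keep one
letter per row. By Gilbert's bound, for every `q < n_row` there are eventually `q ^ n` words whose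
row sequences have nearly equal energies and pairwise squared distances linear in `n`
(`exists_codebook`). Decoder `j` accepts when the score `∑ₜ W(yₜ | u_{j,t})` is not far below the
energy of `u_j`, which is its mean when `u_j` is sent. For another word the mean is lower by a
linear amount (`DMC.mean_score_le`), so Chernoff bounds make both errors exponentially small.
Regions may overlap, so separation of the words suffices. -/

lemma DMC.blockProb_mono (Ch : DMC X Y) {n : ℕ} (u : Fin n → X) {D E : Set (Fin n → Y)}
    (h : D ⊆ E) : Ch.blockProb u D ≤ Ch.blockProb u E :=
  Finset.sum_le_sum fun y _ => Set.indicator_le_indicator_of_subset h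
    (fun y => Finset.prod_nonneg fun t _ => Ch.nonneg (u t) (y t)) y

lemma DMC.blockProb_add_compl (Ch : DMC X Y) {n : ℕ} (u : Fin n → X) (D : Set (Fin n → Y)) :
    Ch.blockProb u D + Ch.blockProb u Dᶜ = 1 := by
  classical
  have h : ∏ t, ∑ y, Ch.W (u t) y = 1 := by simp only [Ch.row_sum, Finset.prod_const_one]
  rw [Fintype.prod_sum] at h
  unfold DMC.blockProb
  rw [← Finset.sum_add_distrib, ← h]
  exact Finset.sum_congr rfl fun y _ => Set.indicator_self_add_compl_apply D _ y

lemma DMC.blockProb_congr (Ch : DMC X Y) {n : ℕ} {u v : Fin n → X}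
    (h : ∀ t, Ch.W (u t) = Ch.W (v t)) (D : Set (Fin n → Y)) :
    Ch.blockProb u D = Ch.blockProb v D := by
  simp only [DMC.blockProb, h]

/-- Chernoff bound for a sum of independent centred variables bounded by `1`. -/
lemma DMC.blockProb_sum_ge_le (Ch : DMC X Y) {n : ℕ} (u : Fin n → X) (h : Fin n → Y → ℝ)
    (hb : ∀ t y, |h t y| ≤ 1) (h0 : ∀ t, ∑ y, Ch.W (u t) y * h t y = 0)
    {a : ℝ} (ha : 0 ≤ a) (ha2 : a ≤ 2) :
    Ch.blockProb u {y | a * n ≤ ∑ t, h t (y t)} ≤ Real.exp (-(a ^ 2 / 4)) ^ n := by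
  classical
  -- This minimises the exponent `s ^ 2 - s * a`; `a ≤ 2` keeps `s * h` in `[-1, 1]`, where `exp x ≤
  -- 1 + x + x ^ 2`.
  set s := a / 2 with hs
  have hs0 : 0 ≤ s := by positivity
  have hs1 : s ≤ 1 := by linarith
  have hmgf : ∀ t, ∑ y, Ch.W (u t) y * Real.exp (s * h t y) ≤ Real.exp (s ^ 2) := by
    intro t
    have hpt : ∀ y, Ch.W (u t) y * Real.exp (s * h t y) ≤
        Ch.W (u t) y * (1 + s ^ 2) + s * (Ch.W (u t) y * h t y) := by
      intro y
      have h1 : |s * h t y| ≤ 1 := by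
        rw [abs_mul, abs_of_nonneg hs0]
        exact mul_le_one₀ hs1 (abs_nonneg _) (hb t y)
      have h2 := (abs_le.1 (Real.abs_exp_sub_one_sub_id_le h1)).2
      have h3 : h t y ^ 2 ≤ 1 := (sq_le_one_iff_abs_le_one _).2 (hb t y)
      have h4 : (s * h t y) ^ 2 ≤ s ^ 2 := by
        rw [mul_pow]; exact mul_le_of_le_one_right (sq_nonneg s) h3
      have h5 : Real.exp (s * h t y) ≤ 1 + s ^ 2 + s * h t y := by linarith
      calc _ ≤ Ch.W (u t) y * (1 + s ^ 2 + s * h t y) :=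
            mul_le_mul_of_nonneg_left h5 (Ch.nonneg _ _)
        _ = _ := by ring
    calc _ ≤ ∑ y, (Ch.W (u t) y * (1 + s ^ 2) + s * (Ch.W (u t) y * h t y)) :=
          Finset.sum_le_sum fun y _ => hpt y
      _ = s ^ 2 + 1 := by
          rw [Finset.sum_add_distrib, ← Finset.sum_mul, ← Finset.mul_sum, Ch.row_sum, h0]; ring
      _ ≤ _ := Real.add_one_le_exp _
  have hpt : ∀ y : Fin n → Y,
      Set.indicator {y : Fin n → Y | a * n ≤ ∑ t, h t (y t)} (fun y => ∏ t, Ch.W (u t) (y t)) y ≤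
        Real.exp (-(s * (a * n))) * ∏ t, (Ch.W (u t) (y t) * Real.exp (s * h t (y t))) := by
    intro y
    rw [Finset.prod_mul_distrib, ← Real.exp_sum, ← Finset.mul_sum, mul_left_comm, ← Real.exp_add]
    have hp : 0 ≤ ∏ t, Ch.W (u t) (y t) := Finset.prod_nonneg fun t _ => Ch.nonneg _ _
    by_cases hy : y ∈ {y : Fin n → Y | a * n ≤ ∑ t, h t (y t)}
    · rw [Set.indicator_of_mem hy]
      refine le_mul_of_one_le_right hp (Real.one_le_exp ?_)
      have := mul_le_mul_of_nonneg_left (Set.mem_ofPred_eq ▸ hy) hs0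
      linarith
    · rw [Set.indicator_of_notMem hy]
      exact mul_nonneg hp (Real.exp_pos _).le
  calc _ ≤ ∑ y : Fin n → Y,
        Real.exp (-(s * (a * n))) * ∏ t, (Ch.W (u t) (y t) * Real.exp (s * h t (y t))) :=
        Finset.sum_le_sum fun y _ => hpt y
    _ = Real.exp (-(s * (a * n))) * ∏ t, ∑ y, Ch.W (u t) y * Real.exp (s * h t y) := by
        rw [← Finset.mul_sum, Fintype.prod_sum]
    _ ≤ Real.exp (-(s * (a * n))) * ∏ _t : Fin n, Real.exp (s ^ 2) := by
        refine mul_le_mul_of_nonneg_left (Finset.prod_le_prod (fun t _ => ?_) fun t _ => hmgf t)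
          (Real.exp_pos _).le
        exact Finset.sum_nonneg fun y _ => mul_nonneg (Ch.nonneg _ _) (Real.exp_pos _).le
    _ = _ := by
        rw [Finset.prod_const, Finset.card_univ, Fintype.card_fin, ← Real.exp_nat_mul,
          ← Real.exp_nat_mul, ← Real.exp_add]
        congr 1
        rw [hs]; ring

lemma DMC.mean_mem_Icc (Ch : DMC X Y) (x : X) {g : Y → ℝ} (hg : ∀ y, g y ∈ Set.Icc (0 : ℝ) 1) :
    ∑ y, Ch.W x y * g y ∈ Set.Icc (0 : ℝ) 1 := by
  refine ⟨Finset.sum_nonneg fun y _ => mul_nonneg (Ch.nonneg _ _) (hg y).1, ?_⟩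
  rw [← Ch.row_sum x]
  exact Finset.sum_le_sum fun y _ => mul_le_of_le_one_right (Ch.nonneg _ _) (hg y).2

lemma DMC.sum_mul_sub_mean (Ch : DMC X Y) (x : X) (g : Y → ℝ) :
    ∑ y, Ch.W x y * (g y - ∑ z, Ch.W x z * g z) = 0 := by
  simp_rw [mul_sub]
  rw [Finset.sum_sub_distrib, ← Finset.sum_mul, Ch.row_sum, one_mul, sub_self]

lemma DMC.blockProb_upper_tail (Ch : DMC X Y) {n : ℕ} (u : Fin n → X) (g : Fin n → Y → ℝ)
    (hg : ∀ t y, g t y ∈ Set.Icc (0 : ℝ) 1) {a : ℝ} (ha : 0 ≤ a) (ha2 : a ≤ 2) :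
    Ch.blockProb u {y | (∑ t, ∑ z, Ch.W (u t) z * g t z) + a * n ≤ ∑ t, g t (y t)} ≤
      Real.exp (-(a ^ 2 / 4)) ^ n := by
  refine le_trans (Ch.blockProb_mono u ?_) (Ch.blockProb_sum_ge_le u
    (fun t y => g t y - ∑ z, Ch.W (u t) z * g t z) (fun t y => ?_)
    (fun t => Ch.sum_mul_sub_mean (u t) (g t)) ha ha2)
  · intro y hy
    simp only [Set.mem_ofPred_eq, Finset.sum_sub_distrib] at hy ⊢
    linarith
  · have h1 := Ch.mean_mem_Icc (u t) (hg t)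
    have h2 := hg t y
    exact abs_le.2 ⟨by linarith [h1.2, h2.1], by linarith [h1.1, h2.2]⟩

lemma DMC.blockProb_lower_tail (Ch : DMC X Y) {n : ℕ} (u : Fin n → X) (g : Fin n → Y → ℝ)
    (hg : ∀ t y, g t y ∈ Set.Icc (0 : ℝ) 1) {a : ℝ} (ha : 0 ≤ a) (ha2 : a ≤ 2) :
    Ch.blockProb u {y | ∑ t, g t (y t) ≤ (∑ t, ∑ z, Ch.W (u t) z * g t z) - a * n} ≤
      Real.exp (-(a ^ 2 / 4)) ^ n := by
  refine le_trans (Ch.blockProb_mono u ?_) (Ch.blockProb_upper_tail u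
    (fun t y => 1 - g t y) (fun t y => ⟨by linarith [(hg t y).2], by linarith [(hg t y).1]⟩) ha ha2)
  intro y hy
  simp only [Set.mem_ofPred_eq, Finset.sum_sub_distrib, mul_sub, mul_one, Ch.row_sum] at hy ⊢
  linarith

lemma DMC.le_one (Ch : DMC X Y) (x : X) (y : Y) : Ch.W x y ≤ 1 := by
  rw [← Ch.row_sum x]
  exact Finset.single_le_sum (fun z _ => Ch.nonneg x z) (Finset.mem_univ y)

/-- The score `∑ₜ W(yₜ | uₜ)` of the codeword `u` identifies `u`: sent words of about the same
energy `∑ₜ ‖W(· | uₜ)‖²` at a linear distance from `u` have a smaller mean score. -/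
lemma DMC.mean_score_le (Ch : DMC X Y) {n : ℕ} (u v : Fin n → X) {γ : ℝ}
    (hdist : 5 * γ * n < ∑ t, ∑ y, (Ch.W (v t) y - Ch.W (u t) y) ^ 2)
    (henergy : ∑ t, ∑ y, Ch.W (v t) y ^ 2 ≤ ∑ t, ∑ y, Ch.W (u t) y ^ 2 + γ * n) :
    ∑ t, ∑ y, Ch.W (v t) y * Ch.W (u t) y ≤ ∑ t, ∑ y, Ch.W (u t) y ^ 2 - 2 * (γ * n) := by
  -- The factor `5 = 2 * 2 + 1` pays for twice the score gap `2 * γ * n` and once the energy slack.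
  have h : ∑ t, ∑ y, (Ch.W (v t) y - Ch.W (u t) y) ^ 2 = ∑ t, ∑ y, Ch.W (v t) y ^ 2
      - 2 * ∑ t, ∑ y, Ch.W (v t) y * Ch.W (u t) y + ∑ t, ∑ y, Ch.W (u t) y ^ 2 := by
    simp only [sub_sq, Finset.sum_add_distrib, Finset.sum_sub_distrib, Finset.mul_sum, mul_assoc]
  linarith

end Concentration

/-! ### Well-separated words of similar weight. -/

section Packing

/-- Gilbert's bound: a finite set covered by balls of at most `V` points contains a separated
subset with at least a `1 / V` share of its points. -/
lemma exists_separated_subset {α : Type*} [DecidableEq α] (S : Finset α) (close : α → α → Prop)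
    [DecidableRel close] (hrefl : ∀ a, close a a) (hsymm : ∀ a b, close a b → close b a) (V : ℝ)
    (hV : ∀ a ∈ S, ((S.filter (close a)).card : ℝ) ≤ V) :
    ∃ C ⊆ S, (∀ a ∈ C, ∀ b ∈ C, a ≠ b → ¬ close a b) ∧ (S.card : ℝ) ≤ C.card * V := by
  -- Balls around a separated set of maximum size cover `S`, since an uncovered point could be
  -- added.
  obtain ⟨C, hC, hmax⟩ := (S.powerset.filter
    fun C => ∀ a ∈ C, ∀ b ∈ C, a ≠ b → ¬ close a b).exists_max_image Finset.card ⟨∅, by simp⟩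
  simp only [Finset.mem_filter, Finset.mem_powerset] at hC hmax
  refine ⟨C, hC.1, hC.2, ?_⟩
  have hcov : S ⊆ C.biUnion fun a => S.filter (close a) := by
    intro b hb
    rw [Finset.mem_biUnion]
    by_contra! hcon
    have hcon' : ∀ a ∈ C, ¬ close a b := fun a ha h => hcon a ha (Finset.mem_filter.2 ⟨hb, h⟩)
    have hbC : b ∉ C := fun h => hcon' b h (hrefl b)
    have := hmax (insert b C) ⟨Finset.insert_subset hb hC.1, ?_⟩
    · rw [Finset.card_insert_of_notMem hbC] at this
      omega
    · intro x hx y hy hxy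
      rcases Finset.mem_insert.1 hx with rfl | hx' <;> rcases Finset.mem_insert.1 hy with rfl | hy'
      · exact absurd rfl hxy
      · exact fun h => hcon' y hy' (hsymm _ _ h)
      · exact hcon' x hx'
      · exact hC.2 x hx' y hy' hxy
  calc (S.card : ℝ) ≤ ((C.biUnion fun a => S.filter (close a)).card : ℝ) := by
        exact_mod_cast Finset.card_le_card hcov
    _ ≤ ∑ a ∈ C, ((S.filter (close a)).card : ℝ) := by exact_mod_cast Finset.card_biUnion_le
    _ ≤ ∑ _a ∈ C, V := Finset.sum_le_sum fun a ha => hV a (hC.1 ha)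
    _ = C.card * V := by rw [Finset.sum_const, nsmul_eq_mul]

variable {Z : Type*} [Fintype Z]

/-- Words with letters of weight in `[0, 1]`, sorted by total weight into intervals of
length `γ n`: the fullest interval holds a share of the words that does not depend on `n`. -/
lemma exists_similar_weight (e : Z → ℝ) (he : ∀ z, e z ∈ Set.Icc (0 : ℝ) 1) {γ : ℝ} (hγ : 0 < γ)
    {n : ℕ} (hn : 0 < n) :
    ∃ S : Finset (Fin n → Z), (∀ u ∈ S, ∀ v ∈ S, ∑ t, e (u t) ≤ ∑ t, e (v t) + γ * n) ∧
      (Fintype.card Z : ℝ) ^ n ≤ (⌊1 / γ⌋₊ + 1 : ℕ) * (S.card : ℝ) := by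
  classical
  have hγn : 0 < γ * n := by positivity
  let f : (Fin n → Z) → ℕ := fun u => ⌊(∑ t, e (u t)) / (γ * n)⌋₊
  have hf0 : ∀ u : Fin n → Z, 0 ≤ (∑ t, e (u t)) / (γ * n) := fun u =>
    div_nonneg (Finset.sum_nonneg fun t _ => (he _).1) hγn.le
  have hmaps : ∀ u ∈ (Finset.univ : Finset (Fin n → Z)), f u ∈ Finset.range (⌊1 / γ⌋₊ + 1) := by
    intro u _
    rw [Finset.mem_range, Nat.lt_succ_iff]
    refine Nat.floor_le_floor ?_
    rw [div_le_div_iff₀ hγn hγ]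
    have : ∑ t, e (u t) ≤ n := by
      calc _ ≤ ∑ _t : Fin n, (1 : ℝ) := Finset.sum_le_sum fun t _ => (he _).2
        _ = n := by simp
    nlinarith
  obtain ⟨k, -, hk⟩ := Finset.exists_max_image (Finset.range (⌊1 / γ⌋₊ + 1))
    (fun k => (Finset.univ.filter fun u => f u = k).card) ⟨0, by simp⟩
  refine ⟨Finset.univ.filter fun u => f u = k, ?_, ?_⟩
  · intro u hu v hv
    have hu' : f u = k := (Finset.mem_filter.1 hu).2
    have hv' : f v = k := (Finset.mem_filter.1 hv).2
    have h1 : (∑ t, e (u t)) / (γ * n) < k + 1 := hu' ▸ Nat.lt_floor_add_one _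
    have h2 : (k : ℝ) ≤ (∑ t, e (v t)) / (γ * n) := hv' ▸ Nat.floor_le (hf0 v)
    rw [div_lt_iff₀ hγn] at h1
    rw [le_div_iff₀ hγn] at h2
    linarith
  · have h1 := Finset.card_eq_sum_card_fiberwise hmaps
    have h2 := Finset.sum_le_card_nsmul _ _ _ hk
    rw [← h1, Finset.card_univ, Fintype.card_fun, Fintype.card_fin, Finset.card_range,
      smul_eq_mul] at h2
    exact_mod_cast h2

/-- The number of words within total distance `θ` of a given word. -/
lemma card_ball_le (d : Z → Z → ℝ) {c l : ℝ} (hl : 0 ≤ l) (hd0 : ∀ a, d a a = 0)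
    (hd : ∀ a b, a ≠ b → c ≤ d a b) {n : ℕ} (u : Fin n → Z) (θ : ℝ) (S : Finset (Fin n → Z))
    (hS : ∀ v ∈ S, ∑ t, d (u t) (v t) ≤ θ) :
    (S.card : ℝ) ≤ Real.exp (l * θ) * (1 + Fintype.card Z * Real.exp (-(l * c))) ^ n := by
  classical
  have hrow : ∀ a, ∑ b, Real.exp (-(l * d a b)) ≤ 1 + Fintype.card Z * Real.exp (-(l * c)) := by
    intro a
    calc _ ≤ ∑ b, ((if b = a then 1 else 0) + Real.exp (-(l * c))) := by
          refine Finset.sum_le_sum fun b _ => ?_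
          split_ifs with h
          · subst h
            simp [hd0, (Real.exp_pos _).le]
          · rw [zero_add]
            exact Real.exp_le_exp.2
              (neg_le_neg (mul_le_mul_of_nonneg_left (hd a b (Ne.symm h)) hl))
      _ = _ := by simp [Finset.sum_add_distrib]
  have hnn : ∀ v : Fin n → Z, 0 ≤ Real.exp (l * θ) * ∏ t, Real.exp (-(l * d (u t) (v t))) :=
    fun v => mul_nonneg (Real.exp_pos _).le (Finset.prod_nonneg fun t _ => (Real.exp_pos _).le)
  -- Exponential Markov bound: `1 ≤ exp (l * (θ - distance))` on the ball, and the right side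
  -- factorises over positions.
  calc (S.card : ℝ) = ∑ _v ∈ S, (1 : ℝ) := by simp
    _ ≤ ∑ v ∈ S, Real.exp (l * θ) * ∏ t, Real.exp (-(l * d (u t) (v t))) := by
        refine Finset.sum_le_sum fun v hv => ?_
        rw [← Real.exp_sum, ← Real.exp_add, Finset.sum_neg_distrib, ← Finset.mul_sum]
        refine Real.one_le_exp ?_
        have := mul_le_mul_of_nonneg_left (hS v hv) hl
        linarith
    _ ≤ ∑ v : Fin n → Z, Real.exp (l * θ) * ∏ t, Real.exp (-(l * d (u t) (v t))) :=
        Finset.sum_le_sum_of_subset_of_nonneg (Finset.subset_univ _) fun v _ _ => hnn v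
    _ = Real.exp (l * θ) * ∏ t, ∑ b, Real.exp (-(l * d (u t) b)) := by
        rw [← Finset.mul_sum, Fintype.prod_sum]
    _ ≤ Real.exp (l * θ) * ∏ _t : Fin n, (1 + Fintype.card Z * Real.exp (-(l * c))) := by
        refine mul_le_mul_of_nonneg_left (Finset.prod_le_prod (fun t _ => ?_) fun t _ => hrow _)
          (Real.exp_pos _).le
        exact Finset.sum_nonneg fun y _ => (Real.exp_pos _).le
    _ = _ := by simp

/-- Codebooks of every exponential rate `q < |Z|` whose words have pairwise distances linear
in `n` and weights that differ by much less. -/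
lemma exists_codebook (d : Z → Z → ℝ) (e : Z → ℝ) (hd0 : ∀ a, d a a = 0)
    (hd : ∀ a b, a ≠ b → 0 < d a b) (hdsymm : ∀ a b, d a b = d b a)
    (he : ∀ z, e z ∈ Set.Icc (0 : ℝ) 1) {q : ℝ} (hq : 0 < q) (hqZ : q < Fintype.card Z) :
    ∃ γ : ℝ, 0 < γ ∧ γ ≤ 1 ∧ ∀ᶠ n : ℕ in atTop, ∃ C : Finset (Fin n → Z),
      q ^ n ≤ C.card ∧ (∀ u ∈ C, ∀ v ∈ C, u ≠ v → 5 * γ * n < ∑ t, d (u t) (v t)) ∧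
      ∀ u ∈ C, ∀ v ∈ C, ∑ t, e (u t) ≤ ∑ t, e (v t) + γ * n := by
  classical
  set r : ℝ := (Fintype.card Z : ℝ)
  have hr0 : 0 < r := hq.trans hqZ
  obtain ⟨c, hc, hcd⟩ : ∃ c : ℝ, 0 < c ∧ ∀ a b, a ≠ b → c ≤ d a b := by
    have hev : ∀ᶠ c in 𝓝[>] (0 : ℝ), ∀ a b, a ≠ b → c ≤ d a b := by
      simp only [eventually_all]
      intro a b hab
      exact Filter.Eventually.filter_mono nhdsWithin_le_nhds (eventually_le_nhds (hd a b hab))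
    obtain ⟨c, h1, h2⟩ := (hev.and self_mem_nhdsWithin).exists
    exact ⟨c, h2, h1⟩
  -- Order of choice: `l` large brings the ball's growth base near `1`, then `γ` small, depending on
  -- `l`, tames the radius factor.
  obtain ⟨l, hl, hlr⟩ : ∃ l : ℝ, 0 ≤ l ∧ q * (1 + r * Real.exp (-(l * c))) < r := by
    have h1 : Tendsto (fun l : ℝ => q * (1 + r * Real.exp (-(l * c)))) atTop
        (𝓝 (q * (1 + r * 0))) :=
      ((Real.tendsto_exp_neg_atTop_nhds_zero.comp
        (tendsto_id.atTop_mul_const hc)).const_mul r |>.const_add 1).const_mul q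
    obtain ⟨l, h1, h2⟩ := ((h1.eventually_lt_const (by simpa using hqZ)).and
      (eventually_ge_atTop 0)).exists
    exact ⟨l, h2, h1⟩
  obtain ⟨γ, hγ, hγ1, hγr⟩ : ∃ γ : ℝ, 0 < γ ∧ γ ≤ 1 ∧
      Real.exp (l * (5 * γ)) * (q * (1 + r * Real.exp (-(l * c)))) < r := by
    have hcont : Continuous fun γ : ℝ =>
        Real.exp (l * (5 * γ)) * (q * (1 + r * Real.exp (-(l * c)))) := by fun_prop
    have h1 := (hcont.tendsto 0).eventually_lt_const (u := r) (by simpa using hlr)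
    obtain ⟨γ, ⟨h1, h2⟩, h3⟩ := (((h1.filter_mono nhdsWithin_le_nhds).and
      ((eventually_le_nhds (zero_lt_one' ℝ)).filter_mono nhdsWithin_le_nhds)).and
      (self_mem_nhdsWithin (s := Set.Ioi (0 : ℝ)))).exists
    exact ⟨γ, h3, h2, h1⟩
  refine ⟨γ, hγ, hγ1, ?_⟩
  set ρ := Real.exp (l * (5 * γ)) * (1 + r * Real.exp (-(l * c))) with hρ
  have hρ0 : 0 < ρ := by positivity
  have hρr : q * ρ < r := by rw [hρ]; linarith
  -- The number of weight classes does not grow with `n`, so the geometric factor absorbs it.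
  have hlim : Tendsto (fun n : ℕ => ((⌊1 / γ⌋₊ + 1 : ℕ) : ℝ) * (q * ρ / r) ^ n) atTop (𝓝 (_ * 0)) :=
    (tendsto_pow_atTop_nhds_zero_of_lt_one (by positivity) ((div_lt_one hr0).2 hρr)).const_mul _
  filter_upwards [hlim.eventually_le_const (u := 1) (by simp), eventually_gt_atTop 0] with n hn hn0
  obtain ⟨S, hS, hcard⟩ := exists_similar_weight e he hγ hn0
  obtain ⟨C, hCS, hsep, hC⟩ := exists_separated_subset S
    (fun u v => ∑ t, d (u t) (v t) ≤ 5 * γ * n)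
    (fun u => by simp only [hd0, Finset.sum_const_zero]; positivity)
    (fun u v h => by simpa only [hdsymm] using h) (ρ ^ n) (by
      intro u _
      refine (card_ball_le d hl hd0 hcd u (5 * γ * n) _
        fun v hv => (Finset.mem_filter.1 hv).2).trans (le_of_eq ?_)
      rw [hρ, mul_pow, ← Real.exp_nat_mul]
      congr 2
      ring)
  refine ⟨C, ?_, fun u hu v hv huv => not_le.1 (hsep u hu v hv huv),
    fun u hu v hv => hS u (hCS hu) v (hCS hv)⟩
  have hB : (0 : ℝ) < (⌊1 / γ⌋₊ + 1 : ℕ) := by positivity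
  have h1 : ((⌊1 / γ⌋₊ + 1 : ℕ) : ℝ) * (q ^ n * ρ ^ n) ≤ r ^ n := by
    rwa [div_pow, ← mul_div_assoc, div_le_one (by positivity), mul_pow] at hn
  have h2 := h1.trans (hcard.trans (mul_le_mul_of_nonneg_left hC hB.le))
  exact le_of_mul_le_mul_right (le_of_mul_le_mul_left h2 hB) (by positivity)

end Packing

/-! ### Converse and achievability. -/

section Capacity

variable {X Y : Type*} [Fintype X] [Fintype Y]

lemma blockCost_le_maxCost (φ : X → ℝ≥0) {n : ℕ} (u : Fin n → X) :
    blockCost φ u ≤ maxCost φ := by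
  unfold blockCost
  rcases Nat.eq_zero_or_pos n with rfl | hn
  · simp
  · have h : ∑ t, φ (u t) ≤ n * maxCost φ := by
      calc _ ≤ ∑ _t : Fin n, maxCost φ :=
            Finset.sum_le_sum fun t _ => Finset.le_sup (f := φ) (Finset.mem_univ _)
        _ = _ := by simp
    rw [one_div, inv_mul_le_iff₀ (by exact_mod_cast hn)]
    exact h

lemma DMC.numRows_pos [Nonempty X] (Ch : DMC X Y) : 0 < Ch.numRows :=
  (Set.ncard_pos (Set.finite_range _)).2 (Set.range_nonempty _)

/-- A code whose two error probabilities add up to less than `1` has at most `n_row ^ n`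
messages. -/
lemma DICode.card_le (Ch : DMC X Y) {φ : X → ℝ≥0} {A : ℝ≥0} {M n : ℕ} (C : DICode X Y φ A M n)
    {lam₁ lam₂ : ℝ} (h₁ : ∀ i, C.errI Ch i ≤ lam₁) (h₂ : ∀ i j, i ≠ j → C.errII Ch i j ≤ lam₂)
    (hlam : lam₁ + lam₂ < 1) : M ≤ Ch.numRows ^ n := by
  classical
  let f : Fin M → Fin n → Set.range (fun x : X => Ch.W x) :=
    fun i t => ⟨Ch.W (C.codeword i t), Set.mem_range_self _⟩
  have hf : Function.Injective f := by
    intro i j hij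
    by_contra hne
    have hrow : ∀ t, Ch.W (C.codeword i t) = Ch.W (C.codeword j t) := fun t =>
      congrArg Subtype.val (congrFun hij t)
    have h3 := h₂ i j hne
    have h4 := h₁ j
    have h5 := Ch.blockProb_add_compl (C.codeword j) (C.region j)
    rw [DICode.errII, Ch.blockProb_congr hrow] at h3
    rw [DICode.errI] at h4
    linarith
  have := Nat.card_le_card_of_injective f hf
  rwa [Nat.card_fun, Nat.card_fin, Nat.card_fin, Nat.card_coe_set_eq] at this

lemma Achievable.le_logb [Nonempty X] {Ch : DMC X Y} {φ : X → ℝ≥0} {A : ℝ≥0} {R : ℝ}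
    (h : Achievable Ch φ A R) : R ≤ Real.logb 2 Ch.numRows := by
  obtain ⟨n₀, hn₀⟩ := h.2 (1 / 4) (1 / 4) (by norm_num) (by norm_num)
  -- `n₀ + 1` is nonzero, so `n`-th roots can be taken below.
  obtain ⟨C, h₁, h₂⟩ := hn₀ (n₀ + 1) (Nat.le_succ _)
  have hle := C.card_le Ch h₁ h₂ (by norm_num)
  have hr : (0 : ℝ) < Ch.numRows := by exact_mod_cast Ch.numRows_pos
  have h3 : (2 : ℝ) ^ (((n₀ + 1 : ℕ) : ℝ) * R) ≤ (Ch.numRows : ℝ) ^ (n₀ + 1) := by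
    exact_mod_cast Nat.ceil_le.1 hle
  rw [mul_comm, Real.rpow_mul (by norm_num), Real.rpow_natCast] at h3
  rw [Real.le_logb_iff_rpow_le (by norm_num) hr]
  exact le_of_pow_le_pow_left₀ (Nat.succ_ne_zero n₀) hr.le h3

lemma achievable_of_lt_logb [Nonempty X] (Ch : DMC X Y) (φ : X → ℝ≥0) {R : ℝ} (hR : 0 < R)
    (hlt : R < Real.logb 2 Ch.numRows) : Achievable Ch φ (maxCost φ) R := by
  classical
  refine ⟨hR, fun lam₁ lam₂ hlam₁ hlam₂ => ?_⟩
  let Z := Set.range (fun x : X => Ch.W x)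
  have hrep : ∀ z : Z, ∃ x, Ch.W x = z := fun z => z.2
  choose rep hrep using hrep
  have : Fintype Z := (Set.finite_range _).fintype
  have hcard : Fintype.card Z = Ch.numRows := by
    rw [← Nat.card_eq_fintype_card, Nat.card_coe_set_eq]; rfl
  have hr : (0 : ℝ) < Ch.numRows := by exact_mod_cast Ch.numRows_pos
  have hW : ∀ x y, Ch.W x y ∈ Set.Icc (0 : ℝ) 1 := fun x y => ⟨Ch.nonneg x y, Ch.le_one x y⟩
  obtain ⟨γ, hγ, hγ1, hev⟩ := exists_codebook (Z := Z)
    (fun a b => ∑ y, (Ch.W (rep a) y - Ch.W (rep b) y) ^ 2) (fun a => ∑ y, Ch.W (rep a) y ^ 2)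
    (fun a => by simp)
    (fun a b hab => by
      refine (Finset.sum_nonneg fun y _ => sq_nonneg _).lt_of_ne fun h0 => hab ?_
      rw [eq_comm, Finset.sum_eq_zero_iff_of_nonneg fun y _ => sq_nonneg _] at h0
      refine Subtype.ext ?_
      rw [← hrep a, ← hrep b]
      exact funext fun y => sub_eq_zero.1 (pow_eq_zero_iff two_ne_zero |>.1 (h0 y (Finset.mem_univ y))))
    (fun a b => Finset.sum_congr rfl fun y _ => by ring)
    (fun a => by simpa only [sq] using Ch.mean_mem_Icc (rep a) (hW (rep a)))
    (q := (2 : ℝ) ^ R) (by positivity)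
    (by rw [hcard]; exact (Real.lt_logb_iff_rpow_lt (by norm_num) hr).1 hlt)
  have hlim : Tendsto (fun n : ℕ => Real.exp (-(γ ^ 2 / 4)) ^ n) atTop (𝓝 0) :=
    tendsto_pow_atTop_nhds_zero_of_lt_one (Real.exp_pos _).le
      (Real.exp_lt_one_iff.2 (by have := pow_pos hγ 2; linarith))
  refine eventually_atTop.1 ?_
  filter_upwards [hev, hlim.eventually_le_const hlam₁, hlim.eventually_le_const hlam₂]
    with n hn hn₁ hn₂
  obtain ⟨C, hCcard, hsep, hen⟩ := hn
  have hM : ⌈(2 : ℝ) ^ ((n : ℝ) * R)⌉₊ ≤ C.card := by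
    rw [Nat.ceil_le, mul_comm, Real.rpow_mul (by norm_num), Real.rpow_natCast]
    exact hCcard
  obtain ⟨ι⟩ : Nonempty (Fin ⌈(2 : ℝ) ^ ((n : ℝ) * R)⌉₊ ↪ C) :=
    Function.Embedding.nonempty_of_card_le (by simpa using hM)
  let word : Fin ⌈(2 : ℝ) ^ ((n : ℝ) * R)⌉₊ → Fin n → X := fun i t => rep ((ι i).1 t)
  -- The threshold lies `γ * n` below the mean for the right word and at least `γ * n` above the
  -- mean for any wrong one.
  refine ⟨⟨word, fun j => {y | ∑ t, ∑ z, Ch.W (word j t) z ^ 2 - γ * n < ∑ t, Ch.W (word j t) (y t)},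
    fun i => blockCost_le_maxCost φ _⟩, fun i => ?_, fun i j hij => ?_⟩
  · refine le_trans (le_trans (Ch.blockProb_mono _ ?_) (Ch.blockProb_lower_tail (word i)
      (fun t => Ch.W (word i t)) (fun t => hW _) hγ.le (hγ1.trans one_le_two))) hn₁
    intro y hy
    simpa only [Set.mem_compl_iff, Set.mem_ofPred_eq, not_lt, sq] using hy
  · refine le_trans (le_trans (Ch.blockProb_mono _ ?_) (Ch.blockProb_upper_tail (word i)
      (fun t => Ch.W (word j t)) (fun t => hW _) hγ.le (hγ1.trans one_le_two))) hn₂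
    intro y hy
    have hne : (ι i).1 ≠ (ι j).1 := fun h => hij (ι.injective (Subtype.ext h))
    have hmean := Ch.mean_score_le (word j) (word i)
      (hsep _ (ι i).2 _ (ι j).2 hne) (hen _ (ι i).2 _ (ι j).2)
    simp only [Set.mem_ofPred_eq] at hy ⊢
    linarith

end Capacity

end DetId

theorem mainTheorem3 {X Y : Type*} [Fintype X] [Nonempty X] [Fintype Y]
    (Ch : DetId.DMC X Y) (φ : X → ℝ≥0) :
    DetId.diCapacity Ch φ (DetId.maxCost φ) = ENNReal.ofReal (Real.logb 2 (Ch.numRows : ℝ)) := by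
  refine le_antisymm (iSup₂_le fun R hR => ENNReal.ofReal_le_ofReal hR.le_logb) ?_
  refine le_of_forall_lt fun b hb => ?_
  -- Even for `b = 0` this gives a strictly positive rate, as `Achievable` demands.
  obtain ⟨c, hbc, hc⟩ := exists_between hb
  have hctop : c ≠ ⊤ := hc.ne_top
  have hc0 : 0 < c.toReal := ENNReal.toReal_pos (pos_of_gt hbc).ne' hctop
  have hlt : c.toReal < Real.logb 2 (Ch.numRows : ℝ) := (ENNReal.lt_ofReal_iff_toReal_lt hctop).1 hc
  refine hbc.trans_le ?_
  calc c = ENNReal.ofReal c.toReal := (ENNReal.ofReal_toReal hctop).symm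
    _ ≤ _ := le_iSup₂_of_le c.toReal (DetId.achievable_of_lt_logb Ch φ hc0 hlt) le_rfl
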